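/- Let $K\ge 1$ and let $G$ be a directed acyclic graph with nodes $1,\dots,K$ that is topologically sorted (every edge $i\to j$ satisfies $i<j$; every finite directed acyclic graph can be labelled in this way). Let $\mathrm{pa}(k)$ be the set of parents of the node $k$; a node $k$ is called a root if $\mathrm{pa}(k)=\emptyset$. Let $d_1,\dots,d_K\ge 1$ be integers, $d=\sum_{k=1}^K d_k$, $\mathcal X_k=[0,1]^{d_k}$ and $\mathcal X=\mathcal X_1\times\dots\times\mathcal X_K=[0,1]^d$, equipped with the norm $\|\cdot\|_\infty$. Let $\mathcal P(\mathcal X)$ be the set of Borel probability measures on $\mathcal X$, and let $$\mathcal P_G=\Big\{\mu\in\mathcal P(\mathcal X)\ :\ \mu(dx_1,\dots,dx_K)=\prod_{k=1}^K\mu(dx_k\mid x_{\mathrm{pa}(k)})\Big\},$$ where $\mu(dx_k\mid x_{\mathrm{pa}(k)})$ is the regular conditional distribution of the $k$-th variable given the variables of its parents (the $k$-th marginal of $\mu$ if $\mathrm{pa}(k)=\emptyset$). Let $\mathcal W(\mu,\nu)=\inf_\pi\int\|x-y\|_\infty\,\pi(dx,dy)$ be the first order Wasserstein distance, where the infimum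 is over all couplings $\pi$ of $\mu$ and $\nu$. There is an absolute constant $C>0$ such that for all $K$, $d_1,\dots,d_K$ and $G$ as above for which $d\ge 3$ and $G$ has exactly one root (for example the graph $1\to2\to\dots\to K$ of Markov chains, or a tree with all edges directed away from a root), and for all $n\ge 8$, $$\inf_{E_n}\ \sup_{\mu\in\mathcal P_G}\ \int \mathcal W(E_n,\mu)\,d\mu^{\otimes n}\ \ge\ C\,n^{-1/d},$$ where the infimum is over all measurable maps $E_n:\mathcal X^n\to\mathcal P(\mathcal X)$. -/

import Mathlib

open MeasureTheory ProbabilityTheory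
open scoped ENNReal

namespace GraphModel

/-- A directed acyclic graph on the nodes `0, …, K - 1` that is topologically sorted:
every edge `i → j` satisfies `i < j` (so there are no loops and no directed cycles). -/
structure SortedDAG (K : ℕ) extends Digraph (Fin K) where
  lt_of_adj : ∀ i j : Fin K, Adj i j → i < j

namespace SortedDAG

variable {K : ℕ}

/-- The set `pa(k)` of parents of the node `k`. -/
def pa (G : SortedDAG K) (k : Fin K) : Set (Fin K) := {j | G.Adj j k}

/-- A root is a node without parents. -/
def IsRoot (G : SortedDAG K) (k : Fin K) : Prop := G.pa k = ∅

end SortedDAG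

/-- The cube `[0,1]^m`. Its distance is the one of the sup norm, its σ-algebra the Borel one. -/
abbrev Cube (m : ℕ) : Type := Fin m → unitInterval

/-- The space `𝒳 = 𝒳_1 × ⋯ × 𝒳_K` with `𝒳_k = [0,1]^{d_k}`, that is, the cube `[0,1]^d` with
`d = ∑ k, d_k` and its coordinates grouped into `K` blocks. Its distance is again the one of
the sup norm. -/
abbrev Space {K : ℕ} (d : Fin K → ℕ) : Type := (k : Fin K) → Cube (d k)

/-- The space `𝒳_I` of the blocks with index in `I`. -/
abbrev SubSpace {K : ℕ} (d : Fin K → ℕ) (I : Set (Fin K)) : Type := (i : I) → Cube (d i)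

/-- The projection `x ↦ x_I` from `𝒳` to `𝒳_I`. -/
def proj {K : ℕ} (d : Fin K → ℕ) (I : Set (Fin K)) (x : Space d) : SubSpace d I :=
  fun i => x i

/-- The projection from `𝒳_J` to `𝒳_I` for `I ⊆ J`. -/
def subProj {K : ℕ} (d : Fin K → ℕ) {I J : Set (Fin K)} (h : I ⊆ J) (x : SubSpace d J) :
    SubSpace d I :=
  fun i => x ⟨i, h i.2⟩

theorem measurable_subProj {K : ℕ} (d : Fin K → ℕ) {I J : Set (Fin K)} (h : I ⊆ J) :
    Measurable (subProj d h) :=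
  measurable_pi_lambda _ fun _ => measurable_pi_apply _

theorem SortedDAG.pa_subset_Iio {K : ℕ} (G : SortedDAG K) (k : Fin K) : G.pa k ⊆ Set.Iio k :=
  fun j hj => G.lt_of_adj j k hj

/-- The regular conditional distribution `μ(dx_k ∣ x_{pa(k)})` of the `k`-th block given the
blocks of the parents of `k`, as a kernel from `𝒳_{pa(k)}` to `𝒳_k`. When `pa(k)` is empty,
`𝒳_{pa(k)}` is a one-point space and this is the `k`-th marginal of `μ`. -/
noncomputable def parentKernel {K : ℕ} (d : Fin K → ℕ) (G : SortedDAG K)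
    (μ : ProbabilityMeasure (Space d)) (k : Fin K) :
    Kernel (SubSpace d (G.pa k)) (Cube (d k)) :=
  condDistrib (fun x : Space d => x k) (proj d (G.pa k)) (μ : Measure (Space d))

instance {K : ℕ} (d : Fin K → ℕ) (G : SortedDAG K) (μ : ProbabilityMeasure (Space d))
    (k : Fin K) : IsMarkovKernel (parentKernel d G μ k) := by
  unfold parentKernel
  infer_instance

/-- The set `𝒫_G` of all probability measures with
`μ(dx_1, …, dx_K) = ∏ k, μ(dx_k ∣ x_{pa(k)})`. The product of kernels is the iterated one, in
the order of the nodes; it is spelled out block by block: for every `k`, the law of the first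
`k` blocks is the law of the blocks before `k`, followed by the kernel `μ(dx_k ∣ x_{pa(k)})`. -/
def modelSet {K : ℕ} (d : Fin K → ℕ) (G : SortedDAG K) : Set (ProbabilityMeasure (Space d)) :=
  {μ | ∀ k : Fin K,
    (μ : Measure (Space d)).map (fun x => (proj d (Set.Iio k) x, x k)) =
      ((μ : Measure (Space d)).map (proj d (Set.Iio k))) ⊗ₘ
        ((parentKernel d G μ k).comap (subProj d (G.pa_subset_Iio k))
          (measurable_subProj d (G.pa_subset_Iio k)))}

/-- The first order Wasserstein distance: the infimum of `∫ dist(x, y) π(dx, dy)` over all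
couplings `π` of `μ` and `ν`. -/
noncomputable def wasserstein {X : Type*} [MeasurableSpace X] [PseudoEMetricSpace X]
    (μ ν : ProbabilityMeasure X) : ℝ≥0∞ :=
  ⨅ π ∈ {π : Measure (X × X) | π.fst = (μ : Measure X) ∧ π.snd = (ν : Measure X)},
    ∫⁻ p, edist p.1 p.2 ∂π

/-- The minimax risk `inf_{E_n} sup_{μ ∈ Q} ∫ W(E_n, μ) dμ^{⊗ n}`, where the infimum ranges over
all estimators, that is, all measurable maps `E_n : X^n → 𝒫(X)`. Here `𝒫(X)` has the σ-algebra
generated by the evaluations `ν ↦ ν(A)`, `A` measurable; for a Polish space with its Borel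
σ-algebra it is the Borel σ-algebra of weak convergence. -/
noncomputable def minimaxRisk {X : Type*} [MeasurableSpace X] [PseudoEMetricSpace X]
    (Q : Set (ProbabilityMeasure X)) (n : ℕ) : ℝ≥0∞ :=
  ⨅ E ∈ {E : (Fin n → X) → ProbabilityMeasure X | Measurable fun x => (E x : Measure X)},
    ⨆ μ ∈ Q, ∫⁻ x, wasserstein (E x) μ ∂(Measure.pi fun _ : Fin n => (μ : Measure X))

end GraphModel

/-! Assouad's method on a finite set. Take 2n pairs of points in the cube, all separated by order
n^(-1/d), and pick one point from each pair by bits `s`; the candidates are the uniform laws on the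
picked points. A sample of size n misses at least half of the pairs, and flipping the unseen bits
leaves the sample unchanged but moves the law far in Wasserstein distance
(`le_wasserstein_flipOutside`). Averaging over `s` gives the bound (`le_minimaxRisk_of_separated`).
The graph costs nothing: the points are perturbed so that each block alone identifies its point
(`exists_separated_points`). With a single root every later node has a parent, which then determines
all preceding blocks, so every candidate lies in the model (`selectionMeasure_mem_modelSet`). -/

namespace GraphModel

open Metric

/-! ### Wasserstein lower bounds from distance functions -/

section Wasserstein

variable {X : Type*} [MeasurableSpace X] [PseudoEMetricSpace X] [OpensMeasurableSpace X]

/-- The easy half of Kantorovich duality: the distance to `A` is 1-Lipschitz, so it can be compared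
pointwise under any coupling. -/
theorem lintegral_infEDist_fst_le (μ ν : ProbabilityMeasure X) (A : Set X) :
    ∫⁻ x, infEDist x A ∂(μ : Measure X) ≤
      ∫⁻ x, infEDist x A ∂(ν : Measure X) + wasserstein μ ν := by
  rw [← tsub_le_iff_left]
  refine le_iInf₂ fun π hπ => ?_
  rw [tsub_le_iff_left, ← hπ.1, ← hπ.2, Measure.fst, Measure.snd,
    lintegral_map measurable_infEDist measurable_fst,
    lintegral_map measurable_infEDist measurable_snd,
    ← lintegral_add_left (measurable_infEDist.fun_comp measurable_snd)]
  exact lintegral_mono fun p => infEDist_le_infEDist_add_edist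

theorem lintegral_infEDist_snd_le (μ ν : ProbabilityMeasure X) (A : Set X) :
    ∫⁻ x, infEDist x A ∂(ν : Measure X) ≤
      ∫⁻ x, infEDist x A ∂(μ : Measure X) + wasserstein μ ν := by
  rw [← tsub_le_iff_left]
  refine le_iInf₂ fun π hπ => ?_
  rw [tsub_le_iff_left, ← hπ.1, ← hπ.2, Measure.fst, Measure.snd,
    lintegral_map measurable_infEDist measurable_fst,
    lintegral_map measurable_infEDist measurable_snd,
    ← lintegral_add_left (measurable_infEDist.fun_comp measurable_fst)]
  refine lintegral_mono fun p => ?_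
  rw [edist_comm]
  exact infEDist_le_infEDist_add_edist

/-- If `ν₁` is carried by `A` and the distance to `A` has `ν₂`-integral at least `r`, then no
measure is close to both `ν₁` and `ν₂`. -/
theorem le_wasserstein_add_wasserstein (μ ν₁ ν₂ : ProbabilityMeasure X) (A : Set X) {r : ℝ≥0∞}
    (h₁ : ∫⁻ x, infEDist x A ∂(ν₁ : Measure X) = 0)
    (h₂ : r ≤ ∫⁻ x, infEDist x A ∂(ν₂ : Measure X)) :
    r ≤ wasserstein μ ν₁ + wasserstein μ ν₂ := by
  have h := lintegral_infEDist_fst_le μ ν₁ A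
  rw [h₁, zero_add] at h
  exact (h₂.trans (lintegral_infEDist_snd_le μ ν₂ A)).trans (by gcongr)

end Wasserstein

/-! ### Flipping unseen bits -/

section Flip

variable {ι : Type*}

/-- Flip the bits of `s` outside of `I`. -/
noncomputable def flipOutside (I : Set ι) (s : ι → Bool) : ι → Bool :=
  open Classical in fun i => if i ∈ I then s i else !s i

theorem flipOutside_involutive (I : Set ι) : Function.Involutive (flipOutside I) := by
  intro s
  funext i
  by_cases h : i ∈ I <;> simp [flipOutside, h]

theorem flipOutside_of_mem {I : Set ι} {i : ι} (h : i ∈ I) (s : ι → Bool) :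
    flipOutside I s i = s i := by simp [flipOutside, h]

theorem flipOutside_of_notMem {I : Set ι} {i : ι} (h : i ∉ I) (s : ι → Bool) :
    flipOutside I s i ≠ s i := by simp [flipOutside, h]

end Flip

/-! ### The averaging argument -/

section Assouad

variable {X : Type*} [MeasurableSpace X]
variable {ι : Type*} [MeasurableSpace ι] [DiscreteMeasurableSpace ι]

/-- The image of the measure `U` under the selection `i ↦ p i (s i)`. -/
noncomputable def selectionMeasure (U : ProbabilityMeasure ι) (p : ι → Bool → X) (s : ι → Bool) :
    ProbabilityMeasure X :=
  U.map (f := fun i => p i (s i)) Measurable.of_discrete.aemeasurable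

theorem selectionMeasure_coe (U : ProbabilityMeasure ι) (p : ι → Bool → X) (s : ι → Bool) :
    (selectionMeasure U p s : Measure X) = (U : Measure ι).map fun i => p i (s i) := rfl

variable [MetricSpace X] [OpensMeasurableSpace X]

/-- The test set is the support of the first selection: each flipped index carries its mass to a
point at distance at least `δ` from it. -/
theorem le_wasserstein_flipOutside (U : ProbabilityMeasure ι) (p : ι → Bool → X) {δ : ℝ≥0∞}
    (hp : ∀ i j b c, (i, b) ≠ (j, c) → δ ≤ edist (p i b) (p j c)) (I : Set ι) (s : ι → Bool)
    (μ : ProbabilityMeasure X) :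
    δ * (U : Measure ι) Iᶜ ≤ wasserstein μ (selectionMeasure U p s) +
      wasserstein μ (selectionMeasure U p (flipOutside I s)) := by
  refine le_wasserstein_add_wasserstein μ _ _ (Set.range fun i => p i (s i)) ?_ ?_
  · rw [selectionMeasure_coe, lintegral_map measurable_infEDist Measurable.of_discrete]
    simp [infEDist_zero_of_mem]
  · rw [selectionMeasure_coe, lintegral_map measurable_infEDist Measurable.of_discrete,
      ← lintegral_indicator_const (MeasurableSet.of_discrete)]
    refine lintegral_mono fun i => ?_
    by_cases hi : i ∈ Iᶜ
    swap
    · simp [Set.indicator_of_notMem hi]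
    rw [Set.indicator_of_mem hi]
    refine le_infEDist.2 ?_
    rintro _ ⟨j, rfl⟩
    refine hp _ _ _ _ fun h => ?_
    obtain ⟨rfl, h⟩ := Prod.mk.inj h
    exact flipOutside_of_notMem hi s h

/-- Let the points `p i b` be `δ`-separated and suppose that a sample of size `n` leaves out a
set of indices of mass at least `a`. Then the minimax risk over a class that contains all
selections is at least `δ * a / 2`. -/
theorem le_minimaxRisk_of_separated [Finite ι] (Q : Set (ProbabilityMeasure X)) (n : ℕ)
    (U : ProbabilityMeasure ι) (p : ι → Bool → X) {δ a : ℝ≥0∞} (hδ : δ ≠ 0)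
    (hp : ∀ i j b c, (i, b) ≠ (j, c) → δ ≤ edist (p i b) (p j c))
    (ha : ∀ I : Fin n → ι, a ≤ (U : Measure ι) (Set.range I)ᶜ)
    (hQ : ∀ s, selectionMeasure U p s ∈ Q) :
    δ * a / 2 ≤ minimaxRisk Q n := by
  classical
  have := Fintype.ofFinite ι
  refine le_iInf₂ fun E _ => ?_
  set R := ⨆ μ ∈ Q, ∫⁻ x, wasserstein (E x) μ ∂(Measure.pi fun _ : Fin n => (μ : Measure X))
  let P : Measure (Fin n → ι) := Measure.pi fun _ => (U : Measure ι)
  let w (s : ι → Bool) (I : Fin n → ι) : ℝ≥0∞ :=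
    wasserstein (E fun j => p (I j) (s (I j))) (selectionMeasure U p s)
  have hR (s) : ∫⁻ I, w s I ∂P ≤ R := by
    refine le_trans (le_of_eq ?_) (le_iSup₂ (selectionMeasure U p s) (hQ s))
    have hinj : Function.Injective fun i => p i (s i) := by
      intro i j hij
      by_contra hne
      have := hp i j (s i) (s j) (by simp [hne])
      simp only at hij
      rw [hij, edist_self] at this
      exact hδ (le_zero_iff.1 this)
    -- Change of variables along an embedding needs no measurability of the integrand, here a
    -- Wasserstein distance.
    have hemb : MeasurableEmbedding fun (I : Fin n → ι) j => p (I j) (s (I j)) :=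
      { injective := fun I J h => funext fun j => hinj (congrFun h j)
        measurable := measurable_of_countable _
        measurableSet_image' := fun _ _ => (Set.toFinite _).measurableSet }
    have hmap : (Measure.pi fun _ : Fin n => (selectionMeasure U p s : Measure X)) =
        P.map fun I j => p (I j) (s (I j)) := by
      simp only [selectionMeasure_coe]
      exact (Measure.pi_map_pi (f := fun _ i => p i (s i))
        fun _ => Measurable.of_discrete.aemeasurable).symm
    rw [hmap, hemb.lintegral_map]
  have hflip (I : Fin n → ι) (s : ι → Bool) :
      δ * a ≤ w s I + w (flipOutside (Set.range I) s) I := by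
    -- The estimator sees only bits at sampled indices, so its value is the same before and after
    -- the flip.
    simp only [w, flipOutside_of_mem (Set.mem_range_self _)]
    exact le_trans (mul_le_mul_right (ha I) δ)
      (le_wasserstein_flipOutside U p hp (Set.range I) s (E fun j => p (I j) (s (I j))))
  have hsum (I : Fin n → ι) : Fintype.card (ι → Bool) * (δ * a) ≤ 2 * ∑ s, w s I := by
    calc _ = ∑ _s : ι → Bool, δ * a := by simp
      _ ≤ ∑ s, (w s I + w (flipOutside (Set.range I) s) I) :=
        Finset.sum_le_sum fun s _ => hflip I s
      _ = 2 * ∑ s, w s I := by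
        rw [Finset.sum_add_distrib, two_mul]
        congr 1
        -- For fixed `I` the flip permutes the bit strings.
        exact Equiv.sum_comp (flipOutside_involutive (Set.range I)).toPerm fun s => w s I
  have key : Fintype.card (ι → Bool) * (δ * a) ≤ Fintype.card (ι → Bool) * (2 * R) := by
    calc _ = ∫⁻ _, Fintype.card (ι → Bool) * (δ * a) ∂P := by simp
      _ ≤ ∫⁻ I, 2 * ∑ s, w s I ∂P := lintegral_mono hsum
      _ = 2 * ∑ s, ∫⁻ I, w s I ∂P := by
        rw [lintegral_const_mul _ (measurable_of_countable _),
          lintegral_finsetSum _ fun _ _ => measurable_of_countable _]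
      _ ≤ 2 * ∑ _s : ι → Bool, R := by gcongr; exact hR _
      _ = _ := by simp; ring
  rw [ENNReal.mul_le_mul_iff_right (by simp) (by simp)] at key
  exact ENNReal.div_le_of_le_mul' key

end Assouad

/-! ### Membership in the graphical model -/

section Model

variable {K : ℕ} {d : Fin K → ℕ} {G : SortedDAG K}

theorem measurable_proj (d : Fin K → ℕ) (I : Set (Fin K)) : Measurable (proj d I) :=
  measurable_pi_lambda _ fun _ => measurable_pi_apply _

/-- A measure belongs to the model if the parents of every node determine all of the preceding
blocks. -/
theorem mem_modelSet_of_determined (μ : ProbabilityMeasure (Space d))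
    (h : ∀ k, ∃ f : SubSpace d (G.pa k) → SubSpace d (Set.Iio k), Measurable f ∧
      ∀ᵐ x ∂(μ : Measure (Space d)), f (proj d (G.pa k) x) = proj d (Set.Iio k) x) :
    μ ∈ modelSet d G := by
  intro k
  obtain ⟨f, hf, hfx⟩ := h k
  have hk : Measurable fun x : Space d => x k := measurable_pi_apply k
  have hI := measurable_proj d (Set.Iio k)
  have hpa := measurable_proj d (G.pa k)
  have hcond : (μ : Measure (Space d)).map (proj d (G.pa k)) ⊗ₘ parentKernel d G μ k =
      (μ : Measure (Space d)).map fun x => (proj d (G.pa k) x, x k) :=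
    compProd_map_condDistrib hk.aemeasurable
  refine Measure.ext_of_lintegral _ fun F hF => ?_
  have hF' : Measurable fun q : SubSpace d (G.pa k) × Cube (d k) => F (f q.1, q.2) := by fun_prop
  rw [lintegral_map hF (hI.prodMk hk), Measure.lintegral_compProd hF,
    lintegral_map (by exact hF.lintegral_kernel_prod_right') hI]
  -- Writing the preceding blocks as `f` of the parents reduces the claim to the defining identity
  -- of the conditional law given the parents.
  calc ∫⁻ x, F (proj d (Set.Iio k) x, x k) ∂(μ : Measure (Space d))
      = ∫⁻ x, F (f (proj d (G.pa k) x), x k) ∂(μ : Measure (Space d)) :=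
        lintegral_congr_ae (hfx.mono fun x hx => by simp only [hx])
    _ = ∫⁻ q, F (f q.1, q.2) ∂((μ : Measure (Space d)).map fun x => (proj d (G.pa k) x, x k)) :=
        (lintegral_map hF' (hpa.prodMk hk)).symm
    _ = ∫⁻ x, ∫⁻ y, F (f (proj d (G.pa k) x), y)
          ∂(parentKernel d G μ k (proj d (G.pa k) x)) ∂(μ : Measure (Space d)) := by
        rw [← hcond, Measure.lintegral_compProd hF',
          lintegral_map (by exact hF'.lintegral_kernel_prod_right') hpa]
    _ = _ := lintegral_congr_ae (hfx.mono fun x hx => by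
        simp only [hx, Kernel.comap_apply]
        rfl)

/-- If there is only one root, then every node except the first has a parent. -/
theorem SortedDAG.pa_nonempty (hG : ∃! k, G.IsRoot k) {j k : Fin K} (h : j < k) :
    (G.pa k).Nonempty := by
  have hK : 0 < K := j.pos
  rw [Set.nonempty_iff_ne_empty]
  intro hk
  -- Edges increase, so the first node is always a root.
  have h0 : G.IsRoot ⟨0, hK⟩ := Set.eq_empty_of_forall_notMem fun i hi =>
    absurd (G.lt_of_adj _ _ hi) (by simp [Fin.lt_def])
  have := hG.unique hk h0
  subst this
  simp [Fin.lt_def] at h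

theorem selectionMeasure_mem_modelSet {ι : Type*} [MeasurableSpace ι] [DiscreteMeasurableSpace ι]
    [Finite ι] (hG : ∃! k, G.IsRoot k) (U : ProbabilityMeasure ι) (p : ι → Bool → Space d)
    (hp : ∀ k i j b c, p i b k = p j c k → i = j) (s : ι → Bool) :
    selectionMeasure U p s ∈ modelSet d G := by
  refine mem_modelSet_of_determined _ fun k => ?_
  by_cases hk : ∃ j, j < k
  · obtain ⟨j, hj⟩ := SortedDAG.pa_nonempty hG hk.choose_spec
    have hemb : MeasurableEmbedding fun i => p i (s i) j :=
      { injective := fun i i' h => hp j i i' _ _ h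
        measurable := Measurable.of_discrete
        measurableSet_image' := fun _ _ => (Set.toFinite _).measurableSet }
    -- The block of one parent reveals the index, hence the whole point; off the finitely many
    -- attained values `f` is arbitrary.
    obtain ⟨f, hf, hfj⟩ := hemb.exists_measurable_extend
      (g := fun i => proj d (Set.Iio k) (p i (s i))) Measurable.of_discrete
      (fun _ => ⟨fun _ _ => 0⟩)
    refine ⟨fun y => f (y ⟨j, hj⟩), by fun_prop, ?_⟩
    rw [selectionMeasure_coe, ae_map_iff Measurable.of_discrete.aemeasurable
      (measurableSet_eq_fun (by unfold proj; fun_prop) (measurable_proj d _))]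
    exact Filter.Eventually.of_forall fun i => congrFun hfj i
  · have : IsEmpty (Set.Iio k) := ⟨fun j => hk ⟨j, j.2⟩⟩
    exact ⟨fun _ _ => 0, measurable_const, Filter.Eventually.of_forall fun x =>
      Subsingleton.elim _ _⟩

end Model

/-! ### Perturbed grid points -/

section Grid

/-- Many separated points in the cube all of whose blocks are pairwise different. -/
theorem exists_separated_points {K : ℕ} (d : Fin K → ℕ) (hd : ∀ k, 1 ≤ d k) (m N : ℕ)
    (hm : 0 < m) (hN : N ≤ m ^ ∑ k, d k) :
    ∃ q : Fin N → Space d, (∀ i j, i ≠ j → ENNReal.ofReal (1 / (2 * m)) ≤ edist (q i) (q j)) ∧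
      ∀ k i j, q i k = q j k → i = j := by
  have hcard : Fintype.card ((k : Fin K) → Fin (d k) → Fin m) = m ^ ∑ k, d k := by
    simp [Finset.prod_pow_eq_pow_sum]
  obtain ⟨g⟩ : Nonempty (Fin N ↪ ((k : Fin K) → Fin (d k) → Fin m)) :=
    Function.Embedding.nonempty_of_card_le (by rw [hcard]; simpa using hN)
  have hm' : (0 : ℝ) < m := by exact_mod_cast hm
  have ht0 (i : Fin N) : 0 ≤ (i : ℝ) / (2 * N) := by positivity
  have ht1 (i : Fin N) : (i : ℝ) / (2 * N) < 1 / 2 := by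
    have hi : (i : ℝ) < N := by exact_mod_cast i.2
    have : (0 : ℝ) < N := lt_of_le_of_lt (Nat.cast_nonneg _) hi
    rw [div_lt_div_iff₀ (by positivity) (by positivity)]
    linarith
  -- Shifting by an amount that depends on `i` makes every single coordinate identify the point. The
  -- shift stays below half a grid step, so distinct cells remain 1/(2m) apart.
  have hx (i : Fin N) (v : Fin m) :
      ((v : ℝ) + (i : ℝ) / (2 * N)) / m ∈ unitInterval := by
    have hv : (v : ℝ) + 1 ≤ m := by exact_mod_cast v.2
    exact ⟨by have := ht0 i; positivity, (div_le_one hm').2 (by linarith [ht1 i])⟩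
  have hcast {u v : Fin m} (h : u ≠ v) : 1 ≤ |(u : ℝ) - v| := by
    have : (u : ℤ) ≠ v := by exact_mod_cast Fin.val_ne_of_ne h
    exact_mod_cast Int.one_le_abs (sub_ne_zero.2 this)
  let x (i : Fin N) (v : Fin m) : unitInterval := ⟨_, hx i v⟩
  have hdist {i j : Fin N} {u v : Fin m} (h : u ≠ v) : 1 / (2 * m) ≤ dist (x i u) (x j v) := by
    have h1 : (1 : ℝ) / 2 ≤ |((u : ℝ) + (i : ℝ) / (2 * N)) - (v + (j : ℝ) / (2 * N))| := by
      have h2 : |(i : ℝ) / (2 * N) - (j : ℝ) / (2 * N)| ≤ 1 / 2 := by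
        rw [abs_le]
        constructor <;> linarith [ht0 i, ht0 j, ht1 i, ht1 j]
      have h3 := abs_sub_abs_le_abs_sub ((u : ℝ) - v) (-((i : ℝ) / (2 * N) - (j : ℝ) / (2 * N)))
      rw [abs_neg] at h3
      calc (1 : ℝ) / 2 ≤ |((u : ℝ) - v) - -((i : ℝ) / (2 * N) - (j : ℝ) / (2 * N))| := by
            linarith [hcast h]
        _ = _ := by congr 1; ring
    rw [Subtype.dist_eq, Real.dist_eq]
    simp only [x]
    rw [← sub_div, abs_div, abs_of_pos hm', le_div_iff₀ hm']
    refine le_trans (le_of_eq ?_) h1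
    field_simp
  refine ⟨fun i k c => x i (g i k c), fun i j hij => ?_, fun k i j hij => ?_⟩
  · obtain ⟨k, hk⟩ := Function.ne_iff.1 (g.injective.ne hij)
    obtain ⟨c, hc⟩ := Function.ne_iff.1 hk
    refine le_trans ?_ ((edist_le_pi_edist _ _ c).trans (edist_le_pi_edist _ _ k))
    rw [edist_dist]
    exact ENNReal.ofReal_le_ofReal (hdist hc)
  · have h := congrFun hij ⟨0, hd k⟩
    have huv : g i k ⟨0, hd k⟩ = g j k ⟨0, hd k⟩ := by
      by_contra hne
      have := hdist (i := i) (j := j) hne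
      rw [show x i (g i k ⟨0, hd k⟩) = x j (g j k ⟨0, hd k⟩) from h, dist_self] at this
      have : (0 : ℝ) < 1 / (2 * m) := by positivity
      linarith
    have h' : ((g i k ⟨0, hd k⟩ : ℝ) + (i : ℝ) / (2 * N)) / m =
        ((g j k ⟨0, hd k⟩ : ℝ) + (j : ℝ) / (2 * N)) / m := congrArg Subtype.val h
    have hN0 : (0 : ℝ) < N := by exact_mod_cast i.pos
    rw [huv, div_left_inj' hm'.ne', add_right_inj, div_left_inj' (by positivity)] at h'
    exact Fin.ext (by exact_mod_cast h')

end Grid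

/-- A sample of size `n` misses at least half of `2 * n` equally likely indices. -/
theorem half_le_uniformOn_compl_range {n : ℕ} (hn : 0 < n) (I : Fin n → Fin (2 * n)) :
    1 / 2 ≤ uniformOn Set.univ (Set.range I)ᶜ := by
  classical
  have hc : n ≤ (Set.range I)ᶜ.toFinset.card := by
    have h1 : (Finset.univ.image I).card ≤ n := by
      simpa using Finset.card_image_le (s := Finset.univ) (f := I)
    have h2 : (Set.range I)ᶜ.toFinset = (Finset.univ.image I)ᶜ := by ext; simp
    rw [h2, Finset.card_compl, Fintype.card_fin]
    omega
  have h3 : (n : ℝ≥0∞) ≤ Measure.count (Set.range I)ᶜ := by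
    rw [← Set.coe_toFinset (Set.range I)ᶜ, Measure.count_apply_finset]
    exact_mod_cast hc
  rw [uniformOn_univ, Fintype.card_fin]
  refine le_trans (le_of_eq ?_) (ENNReal.div_le_div_right h3 _)
  have : (n : ℝ≥0∞) ≠ 0 := by exact_mod_cast hn.ne'
  rw [Nat.cast_mul, ← ENNReal.mul_div_mul_right 1 _ this (ENNReal.natCast_ne_top n), one_mul,
    Nat.cast_ofNat]

end GraphModel

/-! ### Choice of the scale and assembly -/

theorem corollary4p3 :
    ∃ C : ℝ, 0 < C ∧
      ∀ (K : ℕ) (d : Fin K → ℕ) (G : GraphModel.SortedDAG K) (n : ℕ),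
        (∀ k, 1 ≤ d k) → 3 ≤ ∑ k, d k → 8 ≤ n → (∃! k, G.IsRoot k) →
          ENNReal.ofReal (C * (n : ℝ) ^ (-(1 : ℝ) / ((∑ k, d k : ℕ) : ℝ))) ≤
            GraphModel.minimaxRisk (GraphModel.modelSet d G) n := by
  -- The separation 1/(2m), the missed mass 1/2 and the averaging factor 1/2 give 1/(8m), and m ≤
  -- 5r.
  refine ⟨1 / 40, by norm_num, fun K d G n hd hD hn hG => ?_⟩
  set D := ∑ k, d k
  have hD0 : (D : ℝ) ≠ 0 := by
    have : D ≠ 0 := by omega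
    exact_mod_cast this
  have hn0 : (0 : ℝ) ≤ n := Nat.cast_nonneg n
  set r : ℝ := (n : ℝ) ^ ((1 : ℝ) / D)
  have hrD : r ^ D = n := by
    rw [← Real.rpow_natCast, ← Real.rpow_mul hn0, one_div_mul_cancel hD0, Real.rpow_one]
  have hr1 : 1 ≤ r := Real.one_le_rpow (by exact_mod_cast (by omega : 1 ≤ n)) (by positivity)
  have hrinv : (n : ℝ) ^ (-(1 : ℝ) / D) = 1 / r := by
    rw [neg_div, Real.rpow_neg hn0, one_div r]
  -- The factor 4 ensures m^D ≥ 4n, room for 2n pairs.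
  set m := ⌈4 * r⌉₊
  have hm1 : 4 * r ≤ m := Nat.le_ceil _
  have hm2 : (m : ℝ) ≤ 5 * r := by
    have := Nat.ceil_lt_add_one (a := 4 * r) (by positivity)
    linarith
  have hm0 : (0 : ℝ) < m := by linarith
  have hpow : 2 * n * 2 ≤ m ^ D := by
    have h : (4 : ℝ) * n ≤ (m : ℝ) ^ D := by
      calc (4 : ℝ) * n ≤ 4 ^ D * r ^ D := by
            rw [hrD]
            gcongr
            exact le_self_pow₀ (by norm_num) (by omega)
        _ = (4 * r) ^ D := (mul_pow _ _ _).symm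
        _ ≤ _ := by gcongr
    have h' : 4 * n ≤ m ^ D := by exact_mod_cast h
    omega
  obtain ⟨q, hq, hqk⟩ := GraphModel.exists_separated_points d hd m _ (by exact_mod_cast hm0) hpow
  let e : Fin (2 * n) × Bool ≃ Fin (2 * n * 2) :=
    ((Equiv.refl _).prodCongr finTwoEquiv.symm).trans finProdFinEquiv
  have : NeZero (2 * n) := ⟨by omega⟩
  let U : ProbabilityMeasure (Fin (2 * n)) :=
    ⟨uniformOn Set.univ, isProbabilityMeasure_uniformOn Set.finite_univ Set.univ_nonempty⟩
  have h := GraphModel.le_minimaxRisk_of_separated (GraphModel.modelSet d G) n U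
    (fun i b => q (e (i, b))) (δ := ENNReal.ofReal (1 / (2 * m))) (a := 1 / 2)
    (by simp [show 0 < m from mod_cast hm0]) (fun i j b c h => hq _ _ (e.injective.ne h))
    (GraphModel.half_le_uniformOn_compl_range (by omega))
    (GraphModel.selectionMeasure_mem_modelSet hG U _ fun k i j b c h =>
      (Prod.mk.inj (e.injective (hqk k _ _ h))).1)
  refine le_trans ?_ h
  rw [hrinv]
  have : ENNReal.ofReal (1 / (2 * m)) * (1 / 2) / 2 =
      ENNReal.ofReal (1 / (2 * m) * (1 / 2) / 2) := by
    rw [ENNReal.ofReal_div_of_pos two_pos, ENNReal.ofReal_mul (by positivity),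
      ENNReal.ofReal_div_of_pos (y := 2) two_pos]
    simp only [ENNReal.ofReal_one, ENNReal.ofReal_ofNat]
  rw [this]
  refine ENNReal.ofReal_le_ofReal ?_
  have : 1 / (5 * r) ≤ 1 / m := one_div_le_one_div_of_le hm0 hm2
  calc 1 / 40 * (1 / r) ≤ 1 / 8 * (1 / (5 * r)) := by
        apply le_of_eq; field_simp; norm_num
    _ ≤ 1 / 8 * (1 / m) := by gcongr
    _ = _ := by field_simp; norm_num
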